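/- Let $\alpha,\beta>-1$ be real. There is exactly one sequence $(\mathcal P_n^{(\alpha,\beta)})_{n\ge 0}$ of real polynomials such that $\mathcal P_n^{(\alpha,\beta)}$ is monic of degree $n$ for every $n$ and $$\int_{-1}^1 \mathcal P_m^{(\alpha,\beta)}(x)\,\mathcal P_n^{(\alpha,\beta)}(x)\,(1-x)^\alpha(1+x)^\beta\,dx=0\qquad(m\ne n)$$ (the monic Jacobi polynomials). For every integer $n\ge 0$ and every real $x$, $$\mathcal P_n^{(\alpha,\beta)}(x)=\frac{(-2)^n(\beta+1)_n}{(\alpha+\beta+n+1)_n}\;{}_2F_1\!\left(-n,\,n+\alpha+\beta+1;\,\beta+1;\,\frac{1+x}{2}\right)$$ and $$\mathcal P_n^{(\alpha,\beta)}(x)=\frac{2^n(\alpha+1)_n}{(\alpha+\beta+n+1)_n}\;{}_2F_1\!\left(-n,\,n+\alpha+\beta+1;\,\alpha+1;\,\frac{1-x}{2}\right).$$ Here $(a)_n=a(a+1)\cdots(a+n-1)$, $(a)_0=1$, and ${}_2F_1(a,b;c;z)=\sum_{k\ge 0}\frac{(a)_k(b)_k}{(c)_k\,k!}z^k$, which for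 $a=-n$ is a finite sum. -/

import Mathlib

/-- The Jacobi weight `(1 - x) ^ α * (1 + x) ^ β`, used for `x ∈ [-1, 1]`. -/
noncomputable def jacobiWeight (α β x : ℝ) : ℝ :=
  (1 - x) ^ α * (1 + x) ^ β

/-- `P` is the sequence of monic Jacobi polynomials with parameters `α, β`: `P n` is monic of
degree `n`, and the `P n` are pairwise orthogonal on `[-1, 1]` for the Jacobi weight. -/
structure IsMonicJacobi (α β : ℝ) (P : ℕ → Polynomial ℝ) : Prop where
  monic : ∀ n, (P n).Monic
  natDegree_eq : ∀ n, (P n).natDegree = n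
  orthogonal : ∀ m n, m ≠ n →
    ∫ x in (-1 : ℝ)..1, (P m).eval x * (P n).eval x * jacobiWeight α β x = 0

/-- The shifted factorial `(a)_n = a (a + 1) ⋯ (a + n - 1)`. -/
noncomputable def shiftedFactorial (a : ℝ) (n : ℕ) : ℝ :=
  (ascPochhammer ℝ n).eval a

open Polynomial MeasureTheory

/-! Take the first formula as the definition of `monicJacobi`. Under `y = (1 + x) / 2` the
hypergeometric equation becomes an eigenvalue equation for the Jacobi operator
(`jacobiOperator_monicJacobi`). That operator is symmetric for the weight and its eigenvalues are
distinct, so the eigenfunctions are orthogonal. Uniqueness: the difference of two candidates of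
index `n` has degree below `n`, hence is orthogonal to both candidates and so to itself; positivity
of the weight makes it zero. The second formula then follows from the first by
`IsMonicJacobi.reflect` and uniqueness. -/

/-! ### The hypergeometric polynomial and its differential equation -/

/-- The terminating hypergeometric series `₂F₁(-n, b; c; X)` as a polynomial. -/
noncomputable def hypergeometricPolynomial (n : ℕ) (b c : ℝ) : ℝ[X] :=
  ∑ k ∈ Finset.range (n + 1), C (ordinaryHypergeometricCoefficient (-(n : ℝ)) b c k) * X ^ k

theorem ordinaryHypergeometricCoefficient_eq_zero_of_lt {n k : ℕ} (b c : ℝ) (h : n < k) :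
    ordinaryHypergeometricCoefficient (-(n : ℝ)) b c k = 0 := by
  simp [ordinaryHypergeometricCoefficient, ascPochhammer_eval_neg_coe_nat_of_lt h]

theorem coeff_hypergeometricPolynomial (n : ℕ) (b c : ℝ) (k : ℕ) :
    (hypergeometricPolynomial n b c).coeff k =
      ordinaryHypergeometricCoefficient (-(n : ℝ)) b c k := by
  simp only [hypergeometricPolynomial, finsetSum_coeff, coeff_C_mul_X_pow]
  rw [Finset.sum_ite_eq]
  split_ifs with h
  · rfl
  · rw [ordinaryHypergeometricCoefficient_eq_zero_of_lt]
    simpa [Nat.lt_succ_iff] using h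

theorem eval_hypergeometricPolynomial (n : ℕ) (b c y : ℝ) :
    (hypergeometricPolynomial n b c).eval y = ordinaryHypergeometric (-(n : ℝ)) b c y := by
  rw [ordinaryHypergeometric_eq_tsum]
  simp only [smul_eq_mul]
  rw [tsum_eq_sum (s := Finset.range (n + 1))]
  · simp [hypergeometricPolynomial, eval_finsetSum]
  · intro k hk
    have h := ordinaryHypergeometricCoefficient_eq_zero_of_lt (n := n) (k := k) b c
      (by simpa [Nat.lt_succ_iff] using hk)
    simp only [ordinaryHypergeometricCoefficient] at h
    rw [h, zero_mul]

/-- This term ratio is the differential equation below, read coefficient by coefficient. -/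
theorem ordinaryHypergeometricCoefficient_succ (a b : ℝ) {c : ℝ} (hc : 0 < c) (k : ℕ) :
    (k + 1) * (c + k) * ordinaryHypergeometricCoefficient a b c (k + 1) =
      (a + k) * (b + k) * ordinaryHypergeometricCoefficient a b c k := by
  have h1 : (ascPochhammer ℝ k).eval c ≠ 0 := (ascPochhammer_pos k c hc).ne'
  have h2 : c + k ≠ 0 := by positivity
  simp only [ordinaryHypergeometricCoefficient, ascPochhammer_succ_eval, Nat.factorial_succ]
  push_cast
  field_simp

/-- The hypergeometric differential equation. -/
theorem hypergeometricPolynomial_ode (n : ℕ) (b : ℝ) {c : ℝ} (hc : 0 < c) :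
    X * derivative (derivative (hypergeometricPolynomial n b c))
      - X * (X * derivative (derivative (hypergeometricPolynomial n b c)))
      + C c * derivative (hypergeometricPolynomial n b c)
      - C (b - n + 1) * (X * derivative (hypergeometricPolynomial n b c))
      + C (n * b) * hypergeometricPolynomial n b c = 0 := by
  ext k
  have h := ordinaryHypergeometricCoefficient_succ (-(n : ℝ)) b hc k
  rcases k with _ | _ | k <;>
  · simp only [coeff_add, coeff_sub, coeff_C_mul, coeff_X_mul, coeff_X_mul_zero, coeff_zero,
      coeff_derivative, coeff_hypergeometricPolynomial] at h ⊢
    push_cast at h ⊢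
    linear_combination h

/-! ### The candidate and its normalisation -/

/-- The monic Jacobi polynomial in its hypergeometric form at `x = -1`. -/
noncomputable def monicJacobi (α β : ℝ) (n : ℕ) : ℝ[X] :=
  C ((-2 : ℝ) ^ n * shiftedFactorial (β + 1) n / shiftedFactorial (α + β + n + 1) n) *
    (hypergeometricPolynomial n (n + α + β + 1) (β + 1)).comp (C (1 / 2) * X + C (1 / 2))

theorem eval_monicJacobi (α β : ℝ) (n : ℕ) (x : ℝ) :
    (monicJacobi α β n).eval x =
      (-2 : ℝ) ^ n * shiftedFactorial (β + 1) n / shiftedFactorial (α + β + n + 1) n *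
        ordinaryHypergeometric (-(n : ℝ)) ((n : ℝ) + α + β + 1) (β + 1) ((1 + x) / 2) := by
  have h : (1 / 2 : ℝ) * x + 1 / 2 = (1 + x) / 2 := by ring
  simp only [monicJacobi, eval_mul, eval_C, eval_comp, eval_add, eval_X,
    eval_hypergeometricPolynomial, h]

theorem shiftedFactorial_pos_of_jacobi {α β : ℝ} (hα : -1 < α) (hβ : -1 < β) (n : ℕ) :
    0 < shiftedFactorial (α + β + n + 1) n := by
  -- For `n = 0` the base `α + β + 1` may be negative, but the product is empty.
  rcases n with _ | n
  · simp [shiftedFactorial]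
  · apply ascPochhammer_pos
    push_cast
    have : (0 : ℝ) ≤ n := n.cast_nonneg
    linarith

theorem natDegree_hypergeometricPolynomial_le (n : ℕ) (b c : ℝ) :
    (hypergeometricPolynomial n b c).natDegree ≤ n := by
  rw [natDegree_le_iff_coeff_eq_zero]
  intro k hk
  rw [coeff_hypergeometricPolynomial, ordinaryHypergeometricCoefficient_eq_zero_of_lt _ _ hk]

theorem ascPochhammer_eval_neg_self (n : ℕ) :
    (ascPochhammer ℝ n).eval (-(n : ℝ)) = (-1) ^ n * n.factorial := by
  rw [ascPochhammer_eval_neg_eq_descPochhammer, descPochhammer_eval_eq_descFactorial,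
    Nat.descFactorial_self]

theorem monicJacobi_natDegree_le (α β : ℝ) (n : ℕ) : (monicJacobi α β n).natDegree ≤ n := by
  refine (natDegree_C_mul_le _ _).trans (natDegree_comp_le.trans ?_)
  calc _ ≤ n * 1 := Nat.mul_le_mul (natDegree_hypergeometricPolynomial_le _ _ _)
        (natDegree_linear_le)
    _ = n := mul_one n

theorem coeff_comp_linear {R : Type*} [CommRing R] {p : R[X]} {n : ℕ} (hp : p.natDegree ≤ n)
    (a b : R) : (p.comp (C a * X + C b)).coeff n = p.coeff n * a ^ n := by
  rw [comp, eval₂_eq_sum_range' _ (Nat.lt_succ_of_le hp), finsetSum_coeff,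
    Finset.sum_range_succ, Finset.sum_eq_zero, zero_add, coeff_C_mul]
  · congr 1
    simpa using coeff_pow_of_natDegree_le (p := C a * X + C b) (m := n) (n := 1)
      natDegree_linear_le
  · intro k hk
    rw [coeff_C_mul]
    refine mul_eq_zero_of_right _ (coeff_eq_zero_of_natDegree_lt ?_)
    refine (natDegree_pow_le_of_le k natDegree_linear_le).trans_lt ?_
    simpa using hk

theorem coeff_monicJacobi {α β : ℝ} (hα : -1 < α) (hβ : -1 < β) (n : ℕ) :
    (monicJacobi α β n).coeff n = 1 := by
  have h1 := (shiftedFactorial_pos_of_jacobi hα hβ n).ne'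
  have h2 : (ascPochhammer ℝ n).eval (β + 1) ≠ 0 :=
    (ascPochhammer_pos n (β + 1) (by linarith)).ne'
  have h3 : (n.factorial : ℝ) ≠ 0 := by positivity
  have h4 : (n : ℝ) + α + β + 1 = α + β + n + 1 := by ring
  rw [monicJacobi, coeff_C_mul, coeff_comp_linear (natDegree_hypergeometricPolynomial_le _ _ _),
    coeff_hypergeometricPolynomial, ordinaryHypergeometricCoefficient,
    ascPochhammer_eval_neg_self, h4]
  simp only [shiftedFactorial] at h1 ⊢
  -- The signs come from `(-n)_n`, the halves from the substitution `(1 + x) / 2`.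
  have h5 : (-2 : ℝ) ^ n * (-1) ^ n * (1 / 2) ^ n = 1 := by
    rw [← mul_pow, ← mul_pow]; norm_num
  field_simp
  field_simp at h5
  linarith

theorem monic_monicJacobi {α β : ℝ} (hα : -1 < α) (hβ : -1 < β) (n : ℕ) :
    (monicJacobi α β n).Monic :=
  monic_of_natDegree_le_of_coeff_eq_one n (monicJacobi_natDegree_le α β n)
    (coeff_monicJacobi hα hβ n)

theorem natDegree_monicJacobi {α β : ℝ} (hα : -1 < α) (hβ : -1 < β) (n : ℕ) :
    (monicJacobi α β n).natDegree = n :=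
  natDegree_eq_of_le_of_coeff_ne_zero (monicJacobi_natDegree_le α β n)
    (by rw [coeff_monicJacobi hα hβ]; exact one_ne_zero)

/-! ### Orthogonality through the Jacobi operator -/

/-- The Jacobi differential operator. -/
noncomputable def jacobiOperator (α β : ℝ) (p : ℝ[X]) : ℝ[X] :=
  (1 - X ^ 2) * derivative (derivative p) + (C (β - α) - C (α + β + 2) * X) * derivative p

theorem jacobiOperator_monicJacobi (α : ℝ) {β : ℝ} (hβ : -1 < β) (n : ℕ) :
    jacobiOperator α β (monicJacobi α β n) =
      C (-(n * (n + α + β + 1) : ℝ)) * monicJacobi α β n := by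
  apply Polynomial.funext
  intro x
  have h := congrArg (eval (1 / 2 * x + 1 / 2))
    (hypergeometricPolynomial_ode n (n + α + β + 1) (c := β + 1) (by linarith))
  simp only [eval_add, eval_sub, eval_mul, eval_C, eval_X, eval_zero] at h
  simp only [jacobiOperator, monicJacobi, derivative_mul, derivative_C, derivative_comp,
    derivative_add, derivative_X, eval_add, eval_sub, eval_mul, eval_C, eval_X, eval_comp,
    eval_one, eval_pow, eval_zero, derivative_zero, derivative_one]
  linear_combination
    ((-2 : ℝ) ^ n * shiftedFactorial (β + 1) n / shiftedFactorial (α + β + n + 1) n) * h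

theorem intervalIntegrable_jacobiWeight {α β : ℝ} (hα : -1 < α) (hβ : -1 < β) :
    IntervalIntegrable (jacobiWeight α β) volume (-1) 1 := by
  -- Splitting at `0` leaves one possibly singular endpoint per half; the right half is a reflected
  -- left half with exchanged exponents.
  have left : ∀ {a b : ℝ}, -1 < b →
      IntervalIntegrable (fun x : ℝ => (1 - x) ^ a * (1 + x) ^ b) volume (-1) 0 := by
    intro a b hb
    apply IntervalIntegrable.continuousOn_mul
    · have := (intervalIntegral.intervalIntegrable_rpow' (a := 0) (b := 1) hb).comp_add_left 1
      simpa using this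
    · refine ContinuousOn.rpow_const (by fun_prop) fun x hx => Or.inl ?_
      rw [Set.uIcc_of_le (by norm_num)] at hx
      linarith [hx.2]
  refine (left hβ).trans (b := 0) ?_
  have := (left (a := β) hα).comp_mul_left (c := -1)
  rw [div_neg, div_one, neg_neg, zero_div] at this
  refine this.symm.congr fun x _ => ?_
  simp only [neg_mul, one_mul, sub_neg_eq_add, ← sub_eq_add_neg]
  exact mul_comm _ _

theorem intervalIntegrable_eval_mul_jacobiWeight {α β : ℝ} (hα : -1 < α) (hβ : -1 < β)
    (p : ℝ[X]) :
    IntervalIntegrable (fun x => p.eval x * jacobiWeight α β x) volume (-1) 1 :=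
  (intervalIntegrable_jacobiWeight hα hβ).continuousOn_mul p.continuous.continuousOn

/-- Integration of polynomials against the Jacobi weight. -/
noncomputable def jacobiIntegral {α β : ℝ} (hα : -1 < α) (hβ : -1 < β) : ℝ[X] →ₗ[ℝ] ℝ where
  toFun p := ∫ x in (-1 : ℝ)..1, p.eval x * jacobiWeight α β x
  map_add' p q := by
    simp only [eval_add, add_mul]
    exact intervalIntegral.integral_add (intervalIntegrable_eval_mul_jacobiWeight hα hβ p)
      (intervalIntegrable_eval_mul_jacobiWeight hα hβ q)
  map_smul' r p := by
    simp only [eval_smul, smul_eq_mul, mul_assoc, RingHom.id_apply]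
    exact intervalIntegral.integral_const_mul _ _

theorem jacobiIntegral_apply {α β : ℝ} (hα : -1 < α) (hβ : -1 < β) (p : ℝ[X]) :
    jacobiIntegral hα hβ p = ∫ x in (-1 : ℝ)..1, p.eval x * jacobiWeight α β x := rfl

/-- The Jacobi operator is symmetric for the Jacobi weight. -/
theorem jacobiIntegral_jacobiOperator_symm {α β : ℝ} (hα : -1 < α) (hβ : -1 < β) (p q : ℝ[X]) :
    jacobiIntegral hα hβ (jacobiOperator α β p * q) =
      jacobiIntegral hα hβ (p * jacobiOperator α β q) := by
  rw [← sub_eq_zero, ← map_sub, jacobiIntegral_apply]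
  -- Lagrange's identity: the integrand is the derivative of `(1 - x) ^ (α + 1) * (1 + x) ^ (β + 1)
  -- * W`, which vanishes at both endpoints because the exponents are positive.
  set W := derivative p * q - p * derivative q with hW
  have hα' : 0 < α + 1 := by linarith
  have hβ' : 0 < β + 1 := by linarith
  have hcont : ContinuousOn (fun x : ℝ => ((1 - x) ^ (α + 1) * (1 + x) ^ (β + 1)) * W.eval x)
      (Set.Icc (-1) 1) := by
    refine ((ContinuousOn.rpow_const (by fun_prop) fun x _ => Or.inr hα'.le).mul
      (ContinuousOn.rpow_const (by fun_prop) fun x _ => Or.inr hβ'.le)).mul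
      W.continuous.continuousOn
  rw [intervalIntegral.integral_eq_sub_of_hasDerivAt_of_le (by norm_num) hcont ?_
    (intervalIntegrable_eval_mul_jacobiWeight hα hβ _)]
  · simp [Real.zero_rpow hα'.ne', Real.zero_rpow hβ'.ne']
  · intro x hx
    have h1 : 0 < 1 - x := by linarith [hx.2]
    have h2 : 0 < 1 + x := by linarith [hx.1]
    have d1 := ((hasDerivAt_id x).const_sub 1).rpow_const (p := α + 1) (Or.inl h1.ne')
    have d2 := ((hasDerivAt_id x).const_add 1).rpow_const (p := β + 1) (Or.inl h2.ne')
    refine ((d1.mul d2).mul (W.hasDerivAt x)).congr_deriv ?_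
    simp only [id, Pi.mul_apply, add_sub_cancel_right, Real.rpow_add_one h1.ne', Real.rpow_add_one h2.ne',
      jacobiWeight, jacobiOperator, hW, derivative_sub, derivative_mul, eval_add, eval_sub,
      eval_mul, eval_C, eval_X, eval_one, eval_pow]
    ring

theorem isMonicJacobi_monicJacobi {α β : ℝ} (hα : -1 < α) (hβ : -1 < β) :
    IsMonicJacobi α β (monicJacobi α β) where
  monic := monic_monicJacobi hα hβ
  natDegree_eq := natDegree_monicJacobi hα hβ
  orthogonal m n hmn := by
    have h := jacobiIntegral_jacobiOperator_symm hα hβ (monicJacobi α β m) (monicJacobi α β n)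
    rw [jacobiOperator_monicJacobi α hβ, jacobiOperator_monicJacobi α hβ, mul_left_comm _ (C _),
      mul_assoc, ← smul_eq_C_mul, ← smul_eq_C_mul, map_smul, map_smul, smul_eq_mul, smul_eq_mul,
      ← sub_eq_zero, ← sub_mul, mul_eq_zero] at h
    -- The difference is `(n - m) * (m + n + α + β + 1)`; the last factor is positive since `m ≠ n`
    -- forces `m + n ≥ 1`.
    have hne : -((m : ℝ) * (m + α + β + 1)) - -(n * (n + α + β + 1)) ≠ 0 := by
      have h1 : (n : ℝ) - m ≠ 0 := sub_ne_zero.2 (by exact_mod_cast hmn.symm)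
      have h2 : (1 : ℝ) ≤ m + n := by
        have : 1 ≤ m + n := by omega
        exact_mod_cast this
      have h3 : (m : ℝ) + n + α + β + 1 ≠ 0 := by
        apply ne_of_gt
        linarith
      convert mul_ne_zero h1 h3 using 1
      ring
    simpa [jacobiIntegral_apply] using h.resolve_left hne

/-! ### Uniqueness and reflection -/

/-- The weight is positive on the open interval, so `p` vanishes almost everywhere there, then
everywhere there by continuity, and has infinitely many roots. -/
theorem eq_zero_of_jacobiIntegral_sq_eq_zero {α β : ℝ} (hα : -1 < α) (hβ : -1 < β) {p : ℝ[X]}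
    (h : jacobiIntegral hα hβ (p * p) = 0) : p = 0 := by
  have hw : ∀ x ∈ Set.Ioo (-1 : ℝ) 1, 0 < jacobiWeight α β x := fun x hx =>
    mul_pos (Real.rpow_pos_of_pos (by linarith [hx.2]) _)
      (Real.rpow_pos_of_pos (by linarith [hx.1]) _)
  have hi := intervalIntegrable_eval_mul_jacobiWeight hα hβ (p * p)
  rw [jacobiIntegral_apply, intervalIntegral.integral_of_le (by norm_num),
    integral_Ioc_eq_integral_Ioo, setIntegral_eq_zero_iff_of_nonneg_ae] at h
  · have h0 : (fun x => p.eval x) =ᵐ[volume.restrict (Set.Ioo (-1 : ℝ) 1)] fun _ => 0 := by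
      filter_upwards [h, ae_restrict_mem measurableSet_Ioo] with x hx hx'
      have := (mul_eq_zero.1 hx).resolve_right (hw x hx').ne'
      simpa using this
    have h1 := Measure.eqOn_open_of_ae_eq h0 isOpen_Ioo p.continuous.continuousOn
      continuousOn_const
    refine eq_zero_of_infinite_isRoot p ((Set.Ioo_infinite (by norm_num : (-1 : ℝ) < 1)).mono ?_)
    exact fun x hx => h1 hx
  · filter_upwards [ae_restrict_mem measurableSet_Ioo] with x hx
    rw [eval_mul]
    exact mul_nonneg (mul_self_nonneg _) (hw x hx).le
  · exact ((intervalIntegrable_iff_integrableOn_Ioo_of_le (by norm_num)).1 hi)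

/-- Strong induction on the degree: subtracting a multiple of `P q.natDegree` removes the leading
term of `q` without changing the integral. -/
theorem IsMonicJacobi.jacobiIntegral_mul_eq_zero {α β : ℝ} (hα : -1 < α) (hβ : -1 < β)
    {P : ℕ → ℝ[X]} (hP : IsMonicJacobi α β P) {n : ℕ} {q : ℝ[X]} (hq : q.degree < n) :
    jacobiIntegral hα hβ (q * P n) = 0 := by
  induction hd : q.degree using WellFoundedLT.induction generalizing q with
  | ind d ih =>
    subst hd
    by_cases h0 : q = 0
    · simp [h0]
    have hk : q.natDegree < n := by rwa [natDegree_lt_iff_degree_lt h0]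
    set r := q - C q.leadingCoeff * P q.natDegree with hr
    have hlt : r.degree < q.degree := by
      have hlc : q.leadingCoeff ≠ 0 := leadingCoeff_ne_zero.2 h0
      refine degree_sub_lt_left ?_ h0 ?_
      · rw [degree_C_mul hlc, degree_eq_natDegree h0, degree_eq_natDegree (hP.monic _).ne_zero,
          hP.natDegree_eq]
      · rw [leadingCoeff_mul, leadingCoeff_C, (hP.monic _).leadingCoeff, mul_one]
    have horth : jacobiIntegral hα hβ (P q.natDegree * P n) = 0 := by
      simpa [jacobiIntegral_apply] using hP.orthogonal _ _ hk.ne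
    have hqr : q * P n = r * P n + q.leadingCoeff • (P q.natDegree * P n) := by
      rw [smul_eq_C_mul, hr]
      ring
    rw [hqr, map_add, map_smul, horth, smul_zero, add_zero]
    exact ih _ hlt (hlt.trans hq) rfl

theorem IsMonicJacobi.unique {α β : ℝ} (hα : -1 < α) (hβ : -1 < β) {P Q : ℕ → ℝ[X]}
    (hP : IsMonicJacobi α β P) (hQ : IsMonicJacobi α β Q) : P = Q := by
  funext n
  have hlt : (P n - Q n).degree < n := by
    have hPn : (P n).degree = n := by
      rw [degree_eq_natDegree (hP.monic n).ne_zero, hP.natDegree_eq]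
    have hQn : (Q n).degree = n := by
      rw [degree_eq_natDegree (hQ.monic n).ne_zero, hQ.natDegree_eq]
    rw [← hPn]
    exact degree_sub_lt_left (hPn.trans hQn.symm) (hP.monic n).ne_zero
      ((hP.monic n).leadingCoeff.trans (hQ.monic n).leadingCoeff.symm)
  rw [← sub_eq_zero]
  apply eq_zero_of_jacobiIntegral_sq_eq_zero hα hβ
  rw [mul_sub, map_sub, hP.jacobiIntegral_mul_eq_zero hα hβ hlt,
    hQ.jacobiIntegral_mul_eq_zero hα hβ hlt, sub_zero]

/-- The reflection `x ↦ -x` exchanges the two parameters. -/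
theorem IsMonicJacobi.reflect {α β : ℝ} {P : ℕ → ℝ[X]} (hP : IsMonicJacobi α β P) :
    IsMonicJacobi β α fun n => C ((-1) ^ n) * (P n).comp (-X) where
  monic n := by
    rw [Monic, leadingCoeff_mul, leadingCoeff_C, leadingCoeff_comp (by simp),
      (hP.monic n).leadingCoeff, hP.natDegree_eq, leadingCoeff_neg, leadingCoeff_X, one_mul,
      ← mul_pow]
    norm_num
  natDegree_eq n := by
    rw [natDegree_C_mul (by positivity), natDegree_comp, natDegree_neg, natDegree_X, mul_one,
      hP.natDegree_eq]
  orthogonal m n hmn := by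
    have h := hP.orthogonal m n hmn
    have h' := intervalIntegral.integral_comp_neg (a := -1) (b := 1)
      fun x => (P m).eval x * (P n).eval x * jacobiWeight α β x
    rw [neg_neg, h] at h'
    have hw : ∀ x, jacobiWeight β α x = jacobiWeight α β (-x) := fun x => by
      simp only [jacobiWeight, sub_neg_eq_add, ← sub_eq_add_neg]
      exact mul_comm _ _
    have he : ∀ x, (C ((-1) ^ m) * (P m).comp (-X)).eval x *
        (C ((-1) ^ n) * (P n).comp (-X)).eval x * jacobiWeight β α x =
        ((-1) ^ m * (-1) ^ n) *
          ((P m).eval (-x) * (P n).eval (-x) * jacobiWeight α β (-x)) := fun x => by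
      rw [hw]
      simp only [eval_mul, eval_C, eval_comp, eval_neg, eval_X]
      ring
    simp only [he]
    rw [intervalIntegral.integral_const_mul, h', mul_zero]

theorem mainTheorem6 (α β : ℝ) (hα : -1 < α) (hβ : -1 < β) :
    (∃! P : ℕ → Polynomial ℝ, IsMonicJacobi α β P) ∧
    ∀ P : ℕ → Polynomial ℝ, IsMonicJacobi α β P → ∀ (n : ℕ) (x : ℝ),
      (P n).eval x =
          (-2 : ℝ) ^ n * shiftedFactorial (β + 1) n / shiftedFactorial (α + β + n + 1) n *
            ordinaryHypergeometric (-(n : ℝ)) ((n : ℝ) + α + β + 1) (β + 1) ((1 + x) / 2) ∧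
      (P n).eval x =
          (2 : ℝ) ^ n * shiftedFactorial (α + 1) n / shiftedFactorial (α + β + n + 1) n *
            ordinaryHypergeometric (-(n : ℝ)) ((n : ℝ) + α + β + 1) (α + 1) ((1 - x) / 2) := by
  refine ⟨⟨monicJacobi α β, isMonicJacobi_monicJacobi hα hβ, fun Q hQ =>
    hQ.unique hα hβ (isMonicJacobi_monicJacobi hα hβ)⟩, fun P hP n x => ⟨?_, ?_⟩⟩
  · rw [hP.unique hα hβ (isMonicJacobi_monicJacobi hα hβ), eval_monicJacobi]
  -- At `-x`, the reflected sequence takes the value `(-1) ^ n * (P n).eval x`, and `(1 + x) / 2`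
  -- turns into `(1 - x) / 2`.
  · have h := congrArg (eval (-x))
      (congrFun (hP.reflect.unique hβ hα (isMonicJacobi_monicJacobi hβ hα)) n)
    have hs : (-1 : ℝ) ^ n * (-1) ^ n = 1 := by rw [← mul_pow]; norm_num
    have h2 : (-2 : ℝ) ^ n = (-1) ^ n * 2 ^ n := by rw [← mul_pow]; norm_num
    rw [eval_monicJacobi, eval_mul, eval_C, eval_comp, eval_neg, eval_X, neg_neg,
      ← sub_eq_add_neg, h2, add_comm β α, add_right_comm (n : ℝ) β α] at h
    linear_combination (-1 : ℝ) ^ n * h - ((P n).eval x - 2 ^ n * shiftedFactorial (α + 1) n /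
      shiftedFactorial (α + β + n + 1) n * ordinaryHypergeometric (-(n : ℝ))
        ((n : ℝ) + α + β + 1) (α + 1) ((1 - x) / 2)) * hs
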